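/- **Setting.** Let $\mathcal D$ and $\mathcal K$ be complex pre-Hilbert spaces (inner products are antilinear in the left argument), where $\mathcal K$ plays the role of the pre-Hilbert space associated with an Itô algebra. Let $B$ be a unital semigroup with involution, $(x^\star y)^\star=y^\star x$. For a complex vector space $V$ let $V'$ be the space of antilinear functionals on $V$, written $v\mapsto\langle v|v'\rangle$; a linear operator $Q:V\to W'$ is identified with the sesquilinear form $\langle w|Qv\rangle$, its adjoint $Q^\dagger:W\to V'$ is given by $\langle v|Q^\dagger w\rangle=\overline{\langle w|Qv\rangle}$, and $\mathcal Q(V)$ is the space of linear operators $V\to V'$. All tensor products with $\mathcal D$ and of $\mathcal K$ with $\mathfrak D$, $\mathfrak D_t$ below are algebraic. Let $\mathfrak K$ be the space of square-integrable functions $\mathbb R_+\to\mathcal K$, and $\mathfrak D$ the $\mathcal D$-span of the coherent vectors $f^{\otimes}$, $f\in\mathfrak K$, of the Fock space over $\mathfrak K$, so that $\langle\eta\otimes g^{\otimes}|\zeta\otimes f^{\otimes}\rangle=\langle\eta|\zeta\rangle e^{\langle g|f\rangle}$. For $t\ge 0$ let $\mathfrak D_t\subseteq\mathfrak D$ be spanned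 by the vectors $\zeta\otimes f^{\otimes}$ with $\zeta\in\mathcal D$ and $f$ vanishing a.e. on $[t,\infty)$. For $g$ vanishing on $[t,\infty)$ and $f$ vanishing on $[0,t)$, one puts $(\zeta\otimes g^{\otimes})\otimes f^{\otimes}=\zeta\otimes(g+f)^{\otimes}$. Put $\mathfrak D^\bullet=\mathcal K\otimes\mathfrak D$, $\mathfrak D_t^\bullet=\mathcal K\otimes\mathfrak D_t$. An operator $Q\in\mathcal Q(\mathfrak D)$ is *adapted at $t$* if for every $\eta\in\mathfrak D_t$ there is $\eta'\in\mathfrak D_t'$ with $Q(\eta\otimes f^{\otimes})=\eta'\otimes f^{\otimes}$ for all $f\in\mathfrak K$ vanishing on $[0,t)$, where $\langle\xi\otimes g^{\otimes}|\eta'\otimes f^{\otimes}\rangle=\langle\xi|\eta'\rangle e^{\langle g|f\rangle}$ for $\xi\in\mathfrak D_t$ and $g$ vanishing on $[0,t)$. The same definition is used for operators between $\mathfrak D$, $\mathfrak D^\bullet$ and the duals $\mathfrak D'$, $(\mathfrak D^\bullet)'$, with $\mathfrak D_t^\bullet$ in place of $\mathfrak D_t$ where appropriate. **Processes and differentials.**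 An *adapted positive-definite (PD) quantum stochastic process* over $B$ is a family of maps $\phi_t:B\to\mathcal Q(\mathfrak D)$, $t\ge0$, such that each $\phi_t(x)$ is adapted at $t$ and $$\sum_{k,l}\langle\mathfrak h^l|\phi_t(x_l^\star x_k)\mathfrak h^k\rangle\ge0$$ for all finite sequences $\mathfrak h^k\in\mathfrak D$, $x_k\in B$. Let $\boldsymbol\alpha(r,x)=(\alpha^\mu_\nu(r,x))^{\mu=-,\bullet}_{\nu=+,\bullet}$, $r\ge0$, $x\in B$, be a matrix of operators $$\alpha^-_+:\mathfrak D\to\mathfrak D',\quad \alpha^-_\bullet:\mathfrak D^\bullet\to\mathfrak D',\quad \alpha^\bullet_+:\mathfrak D\to(\mathfrak D^\bullet)',\quad \alpha^\bullet_\bullet:\mathfrak D^\bullet\to(\mathfrak D^\bullet)'.$$ We say that $\phi$ *has the quantum stochastic differential $\boldsymbol\alpha(t)\,d\mathbf A$ at $t\ge0$* if 1. all entries of $\boldsymbol\alpha(r,x)$ are adapted at $r$, for all $r\ge0$, $x\in B$; 2. $\phi_s(x)-\phi_0(x)=\int_0^s\boldsymbol\alpha(r,x)\,d\mathbf A=\sum_{\mu,\nu}\int_0^s\alpha^\mu_\nu(r,x)\,dA^\nu_\mu$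 for all $s\ge0$, $x\in B$, where $A^\bullet_\bullet,A^+_\bullet,A^\bullet_-,A^+_-$ are the exchange, creation, annihilation and time integrators of the Fock space; that is, for $h=\eta\otimes g^{\otimes}$ and $k=\zeta\otimes f^{\otimes}$, with $\eta,\zeta\in\mathcal D$ and $f,g\in\mathfrak K$, $$\langle h|(\phi_s(x)-\phi_0(x))k\rangle=\int_0^s\Big(\langle g(r)\otimes h|\alpha^\bullet_\bullet(r,x)(f(r)\otimes k)\rangle+\langle g(r)\otimes h|\alpha^\bullet_+(r,x)k\rangle+\langle h|\alpha^-_\bullet(r,x)(f(r)\otimes k)\rangle+\langle h|\alpha^-_+(r,x)k\rangle\Big)dr,$$ each of the four terms being integrable on $[0,s]$; 3. $\boldsymbol\alpha(t,x)$ is the derivative at $t$: for all $x\in B$ and $\mathbf h,\mathbf k\in\mathfrak D\oplus\mathfrak D^\bullet$ the function $r\mapsto\langle\mathbf h|\boldsymbol\alpha(r,x)\mathbf k\rangle$ is integrable on some $(t,u]$, $u>t$, and $\lim_{s\downarrow t}\frac1{s-t}\int_t^s\langle\mathbf h|\boldsymbol\alpha(r,x)\mathbf k\rangle\,dr=\langle\mathbf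 h|\boldsymbol\alpha(t,x)\mathbf k\rangle$ (which holds, for example, if these functions are measurable and right-continuous at $t$). No relation between the entries of $\boldsymbol\alpha$ is assumed. In particular $\boldsymbol\alpha$ may take its values $\langle\mathfrak h|\boldsymbol\alpha(t,x)\mathfrak h\rangle$ in the quadruples $(a^\mu_\nu)$ that represent an arbitrary given Itô algebra on $\mathcal K$. **Theorem.** Suppose that the adapted PD process $\phi$ has the quantum stochastic differential $\boldsymbol\alpha(t)\,d\mathbf A$ at a $t\ge0$. Let $\boldsymbol\lambda(x)=\boldsymbol\phi_t(x)+\boldsymbol\alpha(t,x)$ with $\boldsymbol\phi_t(x)=(\phi_t(x)\delta^\mu_\nu)^{\mu=-,\bullet}_{\nu=+,\bullet}$, and let $\boldsymbol\iota(x)=(\phi_t(x)\delta^\mu_-\delta^+_\nu)^{\mu=-,\bullet}_{\nu=+,\bullet}$; that is, $$\boldsymbol\lambda=\begin{pmatrix}\lambda&\lambda_\bullet\\ \lambda^\bullet&\lambda^\bullet_\bullet\end{pmatrix},\qquad \boldsymbol\iota=\begin{pmatrix}\phi_t&0\\0&0\end{pmatrix},$$ $$\lambda=\alpha^-_+(t),\quad\lambda^\bullet=\alpha^\bullet_+(t),\quad\lambda_\bullet=\alpha^-_\bullet(t),\quad\lambda^\bullet_\bullet=\mathbf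 1\otimes\phi_t+\alpha^\bullet_\bullet(t),$$ where $\mathbf 1$ is the identity operator of $\mathcal K$. Then $\boldsymbol\lambda$ is conditionally positive definite with respect to $\boldsymbol\iota$: for all finite sequences $x_k\in B$ and $\boldsymbol\eta^k\in\mathfrak D_t\oplus\mathfrak D_t^\bullet$, $$\sum_{k,l}\langle\boldsymbol\eta^l|\boldsymbol\iota(x_l^\star x_k)\boldsymbol\eta^k\rangle=0\quad\Longrightarrow\quad\sum_{k,l}\langle\boldsymbol\eta^l|\boldsymbol\lambda(x_l^\star x_k)\boldsymbol\eta^k\rangle\ge0 .$$ Moreover, for all $x\in B$, $$\lambda(x^\star)=\lambda(x)^\dagger,\qquad\lambda^\bullet(x^\star)=\lambda_\bullet(x)^\dagger,\qquad\lambda^\bullet_\bullet(x^\star)=\lambda^\bullet_\bullet(x)^\dagger .$$ -/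

import Mathlib

open MeasureTheory Filter Topology
open scoped TensorProduct ComplexOrder ComplexConjugate

noncomputable section

namespace QSGerm

/-! ### The coherent span of the Fock space and its filtration -/

/-- The one-particle space `𝔎 = 𝒦 ⊗ L²(ℝ₊)` of square-integrable `𝒦`-valued functions on
`ℝ₊ = [0, ∞)`; the pre-Hilbert space `𝒦` need not be complete. -/
abbrev OneParticle (K : Type*) [NormedAddCommGroup K] : Type _ :=
  Lp K 2 (volume.restrict (Set.Ici (0 : ℝ)))

/-- The `𝒟`-span `𝔇` of the coherent (exponential) vectors `f^⊗`, `f ∈ 𝔎`, of the Fock space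
over `𝔎`: the finite formal sums `∑_f ζ^f ⊗ f^⊗` with coefficients `ζ^f ∈ 𝒟`.  The Fock space
inner product on it is `coherentInner`; by `coherentCore` it is positive and nondegenerate, i.e.
the coherent vectors are linearly independent and no two formal sums have to be identified. -/
abbrev CoherentSpan (D K : Type*) [NormedAddCommGroup D] [NormedAddCommGroup K] : Type _ :=
  OneParticle K →₀ D

section Coherent

variable {D K : Type*} [NormedAddCommGroup D] [InnerProductSpace ℂ D]
  [NormedAddCommGroup K] [InnerProductSpace ℂ K]

/-- The vector `ζ ⊗ f^⊗`. -/
def coherent (ζ : D) (f : OneParticle K) : CoherentSpan D K :=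
  Finsupp.single f ζ

/-- The Fock space inner product of coherent vectors, `⟨g^⊗ | f^⊗⟩ = exp ⟨g | f⟩`. -/
def coherentKernel (g f : OneParticle K) : ℂ :=
  Complex.exp (inner ℂ g f)

/-- The inner product of `𝔇`: `⟨η ⊗ g^⊗ | ζ ⊗ f^⊗⟩ = ⟨η | ζ⟩ exp ⟨g | f⟩`. -/
def coherentInner (h k : CoherentSpan D K) : ℂ :=
  h.sum fun g η => k.sum fun f ζ => inner ℂ η ζ * coherentKernel g f

theorem coherentInner_coherent (η ζ : D) (g f : OneParticle K) :
    coherentInner (coherent η g) (coherent ζ f) = inner ℂ η ζ * coherentKernel g f := by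
  simp [coherentInner, coherent]

theorem coherentInner_add_left (h h' k : CoherentSpan D K) :
    coherentInner (h + h') k = coherentInner h k + coherentInner h' k := by
  unfold coherentInner
  rw [Finsupp.sum_add_index']
  · intro g; simp
  · intro g η η'
    rw [← Finsupp.sum_add]
    congr 1; funext f ζ
    rw [inner_add_left, add_mul]

theorem coherentInner_smul_left (c : ℂ) (h k : CoherentSpan D K) :
    coherentInner (c • h) k = conj c * coherentInner h k := by
  unfold coherentInner
  rw [Finsupp.sum_smul_index' (by intro g; simp)]
  simp only [Finsupp.sum, Finset.mul_sum, inner_smul_left, mul_assoc]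

theorem coherentInner_conj (h k : CoherentSpan D K) :
    conj (coherentInner k h) = coherentInner h k := by
  unfold coherentInner
  simp only [Finsupp.sum, map_sum, map_mul, inner_conj_symm, coherentKernel, ← Complex.exp_conj]
  rw [Finset.sum_comm]

theorem coherentInner_self_nonneg (h : CoherentSpan D K) : 0 ≤ coherentInner h h := by
  classical
  let S := h.support
  let G : Matrix S S ℂ := Matrix.gram ℂ (fun g : S => (g : OneParticle K))
  let A : Matrix S S ℂ := Matrix.gram ℂ (fun g : S => h g)
  have hG : G.PosSemidef := Matrix.posSemidef_gram ℂ _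
  have hA : A.PosSemidef := Matrix.posSemidef_gram ℂ _
  let M : ℕ → Matrix S S ℂ := fun n => Matrix.of fun i j => A i j * (G i j) ^ n
  have hM : ∀ n, (M n).PosSemidef := by
    intro n
    induction n with
    | zero =>
      have : M 0 = A := by ext i j; simp [M]
      rw [this]; exact hA
    | succ n ih =>
      have : M (n + 1) = Matrix.hadamard (M n) G := by
        ext i j; simp [M, Matrix.hadamard, pow_succ, mul_assoc]
      rw [this]; exact ih.hadamard hG
  have hMn : ∀ n, 0 ≤ ∑ i, ∑ j, M n i j := by
    intro n
    have h1 := (Matrix.posSemidef_iff_dotProduct_mulVec.mp (hM n)).2 (fun _ => 1)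
    simpa [dotProduct, Matrix.mulVec] using h1
  have hs : HasSum (fun n : ℕ => ((n.factorial : ℂ))⁻¹ * ∑ i, ∑ j, M n i j)
      (∑ i : S, ∑ j : S, A i j * Complex.exp (G i j)) := by
    have h0 : (fun n : ℕ => ((n.factorial : ℂ))⁻¹ * ∑ i, ∑ j, M n i j) =
        fun n : ℕ => ∑ i, ∑ j, ((n.factorial : ℂ))⁻¹ * M n i j := by
      funext n
      rw [Finset.mul_sum]
      exact Finset.sum_congr rfl fun i _ => Finset.mul_sum _ _ _
    rw [h0]
    refine hasSum_sum fun i _ => hasSum_sum fun j _ => ?_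
    have h2 : HasSum (fun n : ℕ => (G i j) ^ n / (n.factorial : ℂ)) (Complex.exp (G i j)) := by
      rw [Complex.exp_eq_exp_ℂ]
      exact NormedSpace.expSeries_div_hasSum_exp (G i j)
    have h3 : (fun n : ℕ => ((n.factorial : ℂ))⁻¹ * M n i j) =
        fun n : ℕ => A i j * ((G i j) ^ n / (n.factorial : ℂ)) := by
      funext n
      change ((n.factorial : ℂ))⁻¹ * (A i j * G i j ^ n) = _
      ring
    rw [h3]
    exact h2.mul_left (A i j)
  have hfin : coherentInner h h = ∑ i : S, ∑ j : S, A i j * Complex.exp (G i j) := by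
    unfold coherentInner Finsupp.sum
    rw [← Finset.sum_coe_sort]
    refine Finset.sum_congr rfl fun i _ => ?_
    exact (Finset.sum_coe_sort h.support
      (fun f => inner ℂ (h i) (h f) * coherentKernel (i : OneParticle K) f)).symm
  rw [hfin]
  refine hs.nonneg fun n => mul_nonneg ?_ (hMn n)
  positivity

/-- The Fock space inner product makes `𝔇` a pre-Hilbert space. -/
abbrev coherentPreCore : PreInnerProductSpace.Core ℂ (CoherentSpan D K) where
  inner := coherentInner
  conj_inner_symm := coherentInner_conj
  re_inner_nonneg h := (Complex.le_def.mp (coherentInner_self_nonneg h)).1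
  add_left := coherentInner_add_left
  smul_left h k c := coherentInner_smul_left c h k

theorem coherentInner_coherent_left (η : D) (g : OneParticle K) (h : CoherentSpan D K) :
    coherentInner (coherent η g) h = h.sum fun f ζ => inner ℂ η ζ * coherentKernel g f := by
  simp [coherentInner, coherent]

/-- Nondegeneracy: the coherent vectors are linearly independent over `𝒟`. -/
theorem coherentInner_definite (h : CoherentSpan D K) (hh : coherentInner h h = 0) : h = 0 := by
  classical
  have hz : ∀ k : CoherentSpan D K, coherentInner k h = 0 := by
    intro k
    let _ : PreInnerProductSpace.Core ℂ (CoherentSpan D K) := coherentPreCore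
    have h1 := InnerProductSpace.Core.inner_mul_inner_self_le (𝕜 := ℂ) k h
    have h2 : ‖coherentInner k h‖ * ‖coherentInner h k‖ ≤
        RCLike.re (coherentInner k k) * RCLike.re (coherentInner h h) := h1
    rw [hh, ← coherentInner_conj h k, RCLike.norm_conj] at h2
    simp only [map_zero, mul_zero] at h2
    have h3 : ‖coherentInner k h‖ = 0 := by nlinarith [norm_nonneg (coherentInner k h)]
    exact norm_eq_zero.mp h3
  let χ : OneParticle K → (Multiplicative (OneParticle K) →* ℂ) := fun f =>
    { toFun := fun g => Complex.exp (inner ℂ f g.toAdd)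
      map_one' := by simp
      map_mul' := fun a b => by simp [inner_add_right, Complex.exp_add] }
  have hχ : Function.Injective χ := by
    intro f f' hff
    by_contra hne
    have h1 : ∀ (c : ℝ), Complex.exp (c * inner ℂ (f - f') (f - f')) = 1 := by
      intro c
      have h2 := DFunLike.congr_fun hff (Multiplicative.ofAdd ((c : ℂ) • (f - f')))
      simp only [χ, MonoidHom.coe_mk, OneHom.coe_mk, toAdd_ofAdd] at h2
      rw [inner_sub_left, mul_sub, Complex.exp_sub, ← inner_smul_right, ← inner_smul_right, h2,
        div_self (Complex.exp_ne_zero _)]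
    have h3 := h1 1
    rw [inner_self_eq_norm_sq_to_K] at h3
    have h4 : Real.exp (‖f - f'‖ ^ 2) = 1 := by
      have h5 : ((Real.exp (‖f - f'‖ ^ 2) : ℝ) : ℂ) = 1 := by
        push_cast
        simpa using h3
      exact_mod_cast h5
    rw [Real.exp_eq_one_iff] at h4
    exact hne (sub_eq_zero.mp (norm_eq_zero.mp (pow_eq_zero_iff (two_ne_zero) |>.mp h4)))
  have hli := (linearIndependent_monoidHom (Multiplicative (OneParticle K)) ℂ).comp χ hχ
  ext f
  simp only [Finsupp.coe_zero, Pi.zero_apply]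
  refine inner_self_eq_zero (𝕜 := ℂ) |>.mp ?_
  by_cases hf : f ∈ h.support
  swap
  · simp [Finsupp.notMem_support_iff.mp hf]
  have hrel := (linearIndependent_iff'.mp hli) h.support
    (fun f' => conj (inner ℂ (h f) (h f'))) (by
      funext g
      have h1 := hz (coherent (h f) g.toAdd)
      rw [coherentInner_coherent_left, Finsupp.sum] at h1
      have h2 := congrArg conj h1
      simp only [map_sum, map_mul, coherentKernel, ← Complex.exp_conj, inner_conj_symm,
        map_zero] at h2
      simpa [χ] using h2) f hf
  simpa using hrel

/-- `𝔇` with its Fock space inner product is a pre-Hilbert space with a definite norm. -/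
abbrev coherentCore : InnerProductSpace.Core ℂ (CoherentSpan D K) :=
  { coherentPreCore with definite := coherentInner_definite }

/-- `f` lives on `[0, t)`. -/
def SupportedBefore (t : ℝ) (f : OneParticle K) : Prop :=
  ∀ᵐ r ∂volume.restrict (Set.Ici (0 : ℝ)), t ≤ r → f r = 0

/-- `f` lives on `[t, ∞)`. -/
def SupportedFrom (t : ℝ) (f : OneParticle K) : Prop :=
  ∀ᵐ r ∂volume.restrict (Set.Ici (0 : ℝ)), r < t → f r = 0

/-- The subspace `𝔇_t ⊆ 𝔇` generated by `ζ ⊗ f^⊗` with `ζ ∈ 𝒟` and `f` living on `[0, t)`. -/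
def past (D K : Type*) [NormedAddCommGroup D] [InnerProductSpace ℂ D]
    [NormedAddCommGroup K] [InnerProductSpace ℂ K] (t : ℝ) : Submodule ℂ (CoherentSpan D K) :=
  Submodule.span ℂ {h | ∃ (ζ : D) (f : OneParticle K), SupportedBefore t f ∧ h = coherent ζ f}

/-- `h ↦ h ⊗ f^⊗`, that is `(ζ ⊗ g^⊗) ⊗ f^⊗ = ζ ⊗ (g + f)^⊗`.  It is used for `h ∈ 𝔇_t` and `f`
living on `[t, ∞)`, where `g` and `f` have disjoint supports and the Fock space factorizes. -/
def tensorCoherent (f : OneParticle K) : CoherentSpan D K →ₗ[ℂ] CoherentSpan D K :=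
  Finsupp.lmapDomain D ℂ (fun g => g + f)

end Coherent

/-- The space `𝔇^• = 𝒦 ⊗ 𝔇` (algebraic tensor product). -/
abbrev BulletSpan (D K : Type*) [NormedAddCommGroup D] [InnerProductSpace ℂ D]
    [NormedAddCommGroup K] [InnerProductSpace ℂ K] : Type _ :=
  K ⊗[ℂ] CoherentSpan D K

/-- The subspace `𝔇_t^• = 𝒦 ⊗ 𝔇_t` of `𝒦 ⊗ 𝔇`. -/
def bulletPast (D K : Type*) [NormedAddCommGroup D] [InnerProductSpace ℂ D]
    [NormedAddCommGroup K] [InnerProductSpace ℂ K] (t : ℝ) : Submodule ℂ (BulletSpan D K) :=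
  LinearMap.range (LinearMap.lTensor K (past D K t).subtype)

/-- `a ⊗ h ↦ a ⊗ (h ⊗ f^⊗)` on `𝒦 ⊗ 𝔇`. -/
def bulletTensorCoherent {D K : Type*} [NormedAddCommGroup D] [InnerProductSpace ℂ D]
    [NormedAddCommGroup K] [InnerProductSpace ℂ K] (f : OneParticle K) :
    BulletSpan D K →ₗ[ℂ] BulletSpan D K :=
  LinearMap.lTensor K (tensorCoherent f)

/-! ### Form-valued operators -/

/-- The space `W'` of all antilinear functionals on `W`. -/
abbrev AntiDual (W : Type*) [AddCommGroup W] [Module ℂ W] : Type _ :=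
  W →ₗ⋆[ℂ] ℂ

/-- The linear operators `Q : V → W'`, identified with the sesquilinear forms
`⟨w | Q v⟩ = Q v w`.  The space `𝒬(V)` is `FormOp V V`. -/
abbrev FormOp (V W : Type*) [AddCommGroup V] [Module ℂ V] [AddCommGroup W] [Module ℂ W] :
    Type _ :=
  V →ₗ[ℂ] AntiDual W

/-- The Hermitian adjoint `Q† : W → V'` of `Q : V → W'`: `⟨v | Q† w⟩ = ⟨w | Q v⟩^*`. -/
def dagger {V W : Type*} [AddCommGroup V] [Module ℂ V] [AddCommGroup W] [Module ℂ W]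
    (Q : FormOp V W) : FormOp W V :=
  LinearMap.mk₂'ₛₗ (RingHom.id ℂ) (starRingEnd ℂ) (fun w v => conj (Q v w))
    (fun w w' v => by simp) (fun c w v => by simp)
    (fun w v v' => by simp) (fun c w v => by simp)

/-- The ampliation `Q ⊗ 1 = Q δ^•_•` of `Q ∈ 𝒬(V)` to `𝒦 ⊗ V`, where `1` is the identity of `𝒦`:
`⟨a ⊗ h | (Q ⊗ 1)(b ⊗ k)⟩ = ⟨a | b⟩ ⟨h | Q k⟩`. -/
def ampliate (K : Type*) {V : Type*} [NormedAddCommGroup K] [InnerProductSpace ℂ K]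
    [AddCommGroup V] [Module ℂ V] (Q : FormOp V V) : FormOp (K ⊗[ℂ] V) (K ⊗[ℂ] V) :=
  TensorProduct.lift <|
    LinearMap.mk₂' ℂ ℂ
      (fun (b : K) (k : V) =>
        (TensorProduct.lift <|
          LinearMap.mk₂'ₛₗ (starRingEnd ℂ) (starRingEnd ℂ)
            (fun (a : K) (h : V) => inner ℂ a b * Q k h)
            (fun a a' h => by rw [inner_add_left, add_mul])
            (fun c a h => by rw [inner_smul_left, mul_assoc, smul_eq_mul])
            (fun a h h' => by rw [map_add, mul_add])
            (fun c a h => by rw [LinearMap.map_smulₛₗ, smul_eq_mul, smul_eq_mul, mul_left_comm]) : AntiDual (K ⊗[ℂ] V)))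
      (fun b b' k => by ext a h; simp [add_mul])
      (fun c b k => by ext a h; simp [mul_assoc])
      (fun b k k' => by ext a h; simp [mul_add])
      (fun c b k => by ext a h; simp [mul_left_comm])

theorem ampliate_tmul (K : Type*) {V : Type*} [NormedAddCommGroup K] [InnerProductSpace ℂ K]
    [AddCommGroup V] [Module ℂ V] (Q : FormOp V V) (a b : K) (h k : V) :
    ampliate K Q (b ⊗ₜ[ℂ] k) (a ⊗ₜ[ℂ] h) = inner ℂ a b * Q k h := by
  simp [ampliate]

/-- Causality of `Q : V → W'` at time `t`: `Q (v ⊗ f^⊗) = w' ⊗ f^⊗` for all `v ∈ V_t` and all `f`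
living on `[t, ∞)`, with some `w' ∈ W_t'`.  Here `TV f v = v ⊗ f^⊗`, `TW g w = w ⊗ g^⊗`, and
`⟨w ⊗ g^⊗ | w' ⊗ f^⊗⟩ = ⟨w | w'⟩ exp ⟨g | f⟩`. -/
def IsCausal {K V W : Type*} [NormedAddCommGroup K] [InnerProductSpace ℂ K]
    [AddCommGroup V] [Module ℂ V] [AddCommGroup W] [Module ℂ W] (t : ℝ)
    (Vt : Submodule ℂ V) (TV : OneParticle K → V →ₗ[ℂ] V)
    (Wt : Submodule ℂ W) (TW : OneParticle K → W →ₗ[ℂ] W) (Q : FormOp V W) : Prop :=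
  ∀ v ∈ Vt, ∃ w' : AntiDual Wt, ∀ f : OneParticle K, SupportedFrom t f →
    ∀ (w : Wt) (g : OneParticle K), SupportedFrom t g →
      Q (TV f v) (TW g (w : W)) = w' w * coherentKernel g f

/-- Causality of a form in `𝒬(𝔇)` at time `t`. -/
def IsAdaptedForm {D K : Type*} [NormedAddCommGroup D] [InnerProductSpace ℂ D]
    [NormedAddCommGroup K] [InnerProductSpace ℂ K] (t : ℝ)
    (Q : FormOp (CoherentSpan D K) (CoherentSpan D K)) : Prop :=
  IsCausal t (past D K t) tensorCoherent (past D K t) tensorCoherent Q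

/-! ### Block matrices indexed by `μ ∈ {-, •}`, `ν ∈ {+, •}` -/

/-- A matrix `(a^μ_ν)` of form-valued operators, acting on columns in `𝔇 ⊕ (𝒦 ⊗ 𝔇)`:
`mp = a^-_+`, `mb = a^-_•`, `bp = a^•_+`, `bb = a^•_•`. -/
@[ext] structure BlockForm (D K : Type*) [NormedAddCommGroup D] [InnerProductSpace ℂ D]
    [NormedAddCommGroup K] [InnerProductSpace ℂ K] where
  mp : FormOp (CoherentSpan D K) (CoherentSpan D K)
  mb : FormOp (BulletSpan D K) (CoherentSpan D K)
  bp : FormOp (CoherentSpan D K) (BulletSpan D K)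
  bb : FormOp (BulletSpan D K) (BulletSpan D K)

section Germs

variable {B D K : Type*} [NormedAddCommGroup D] [InnerProductSpace ℂ D]
  [NormedAddCommGroup K] [InnerProductSpace ℂ K]

/-- The sesquilinear form `⟨𝐡 | 𝐚 𝐤⟩` of a block matrix on `𝔇 ⊕ (𝒦 ⊗ 𝔇)`. -/
def BlockForm.form (a : BlockForm D K) (h k : CoherentSpan D K × BulletSpan D K) : ℂ :=
  a.mp k.1 h.1 + a.mb k.2 h.1 + a.bp k.1 h.2 + a.bb k.2 h.2

/-- Entrywise sum of block matrices. -/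
instance : Add (BlockForm D K) where
  add a b := ⟨a.mp + b.mp, a.mb + b.mb, a.bp + b.bp, a.bb + b.bb⟩

/-- The matrix `(Q δ^μ_ν)` with `μ ∈ {-, •}`, `ν ∈ {+, •}`: since `- ≠ +`, its only nonzero entry
is `Q δ^•_• = Q ⊗ 1`. -/
def deltaBlock (Q : FormOp (CoherentSpan D K) (CoherentSpan D K)) : BlockForm D K :=
  ⟨0, 0, 0, ampliate K Q⟩

/-- The degenerate matrix `(Q δ^μ_- δ^+_ν)`, whose only nonzero entry is the corner `Q`. -/
def cornerBlock (Q : FormOp (CoherentSpan D K) (CoherentSpan D K)) : BlockForm D K :=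
  ⟨Q, 0, 0, 0⟩

/-- Every entry of the block matrix is causal at time `t`. -/
structure BlockForm.IsAdapted (t : ℝ) (a : BlockForm D K) : Prop where
  mp : IsAdaptedForm t a.mp
  mb : IsCausal t (bulletPast D K t) bulletTensorCoherent (past D K t) tensorCoherent a.mb
  bp : IsCausal t (past D K t) tensorCoherent (bulletPast D K t) bulletTensorCoherent a.bp
  bb : IsCausal t (bulletPast D K t) bulletTensorCoherent
    (bulletPast D K t) bulletTensorCoherent a.bb

/-! ### Positive definite processes, their differentials, and germs -/

/-- Positive definiteness of `φ : B → 𝒬(𝔇)`. -/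
def IsPosDef [Mul B] [Star B] (φ : B → FormOp (CoherentSpan D K) (CoherentSpan D K)) : Prop :=
  ∀ (n : ℕ) (x : Fin n → B) (h : Fin n → CoherentSpan D K),
    0 ≤ ∑ k, ∑ l, φ (star (x l) * x k) (h k) (h l)

/-- A quantum stochastic adapted positive definite process `(φ_t)_{t ≥ 0}` over `B`. -/
structure IsAdaptedPDProcess [Mul B] [Star B]
    (φ : ℝ → B → FormOp (CoherentSpan D K) (CoherentSpan D K)) : Prop where
  posDef : ∀ t, 0 ≤ t → IsPosDef (φ t)
  adapted : ∀ t, 0 ≤ t → ∀ x, IsAdaptedForm t (φ t x)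

/-- `Q = ∫₀ᵗ 𝐚(r) d𝐀 = ∑_{μ,ν} ∫₀ᵗ a^μ_ν(r) dA^ν_μ(r)`, the (weak) quantum stochastic integral with
respect to the exchange `A^•_•`, creation `A^+_•`, annihilation `A^•_-` and time `A^+_-`
integrators.  It is the form on `𝔇` given on coherent vectors by the Hudson-Parthasarathy rule
`⟨g^⊗ | dA^•_•(r) f^⊗⟩ ~ g(r)^* f(r) dr`, `dA^+_• ~ g(r)^* dr`, `dA^•_- ~ f(r) dr`, `dA^+_- ~ dr`;
each of the four integrals has to exist. -/
def IsQSIntegral (a : ℝ → BlockForm D K) (t : ℝ)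
    (Q : FormOp (CoherentSpan D K) (CoherentSpan D K)) : Prop :=
  ∀ (η ζ : D) (g f : OneParticle K),
    let h := coherent η g
    let k := coherent ζ f
    IntervalIntegrable (fun r => (a r).bb (f r ⊗ₜ[ℂ] k) (g r ⊗ₜ[ℂ] h)) volume 0 t ∧
    IntervalIntegrable (fun r => (a r).bp k (g r ⊗ₜ[ℂ] h)) volume 0 t ∧
    IntervalIntegrable (fun r => (a r).mb (f r ⊗ₜ[ℂ] k) h) volume 0 t ∧
    IntervalIntegrable (fun r => (a r).mp k h) volume 0 t ∧
    Q k h =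
      (∫ r in (0 : ℝ)..t, (a r).bb (f r ⊗ₜ[ℂ] k) (g r ⊗ₜ[ℂ] h)) +
      (∫ r in (0 : ℝ)..t, (a r).bp k (g r ⊗ₜ[ℂ] h)) +
      (∫ r in (0 : ℝ)..t, (a r).mb (f r ⊗ₜ[ℂ] k) h) +
      (∫ r in (0 : ℝ)..t, (a r).mp k h)

/-- `F` is integrable on some `(t, u]`, `u > t`, and `F t` is the right derivative at `t` of the
indefinite integral of `F`.  This holds if `F` is measurable and right-continuous at `t`. -/
def IsRightLebesguePoint (F : ℝ → ℂ) (t : ℝ) : Prop :=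
  (∃ u, t < u ∧ IntegrableOn F (Set.Ioc t u)) ∧
    Tendsto (fun s => ((s - t : ℝ) : ℂ)⁻¹ * ∫ r in t..s, F r) (𝓝[>] t) (𝓝 (F t))

/-- `φ` has the quantum stochastic differential `α(t) d𝐀` at `t`: the process `φ` is the quantum
stochastic integral `φ_s(x) - φ_0(x) = ∫₀ˢ α(r, x) d𝐀` of an adapted process `α`, and `α(t, x)` is
the derivative at `t`, i.e. `t` is weakly a right Lebesgue point of `r ↦ α(r, x)`.  (The integral
alone does not see the value of `α` at the single time `t`.) -/
structure HasQSDifferentialAt (φ : ℝ → B → FormOp (CoherentSpan D K) (CoherentSpan D K))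
    (α : ℝ → B → BlockForm D K) (t : ℝ) : Prop where
  adapted : ∀ r, 0 ≤ r → ∀ x, (α r x).IsAdapted r
  integral : ∀ s, 0 ≤ s → ∀ x, IsQSIntegral (fun r => α r x) s (φ s x - φ 0 x)
  regular : ∀ x (h k : CoherentSpan D K × BulletSpan D K),
    IsRightLebesguePoint (fun r => (α r x).form h k) t

/-- The germ-matrix `λ(x) = (φ_t(x) δ^μ_ν) + α(t, x)`. -/
def germ (φ : ℝ → B → FormOp (CoherentSpan D K) (CoherentSpan D K))
    (α : ℝ → B → BlockForm D K) (t : ℝ) (x : B) : BlockForm D K :=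
  deltaBlock (φ t x) + α t x

/-- `Λ` is conditionally positive definite with respect to `I` on columns in `𝔇_t ⊕ 𝔇_t^•`. -/
def IsCondPosDef [Mul B] [Star B] (t : ℝ) (I Λ : B → BlockForm D K) : Prop :=
  ∀ (n : ℕ) (x : Fin n → B) (η : Fin n → CoherentSpan D K × BulletSpan D K),
    (∀ k, (η k).1 ∈ past D K t ∧ (η k).2 ∈ bulletPast D K t) →
    ∑ k, ∑ l, (I (star (x l) * x k)).form (η l) (η k) = 0 →
    0 ≤ ∑ k, ∑ l, (Λ (star (x l) * x k)).form (η l) (η k)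

end Germs

end QSGerm

end

/-!
The germ is a right derivative.  Take coherent vectors `ζ ⊗ f^⊗`, `η ⊗ g^⊗` with `f`, `g` living on
`[0, t)`, continue `f` and `g` on `[t, s)` by constants `a, b ∈ 𝒦`, and let `s` decrease to `t`.  Then
the matrix element of `φ_s(x)` between the continued vectors has at `s = t` the right derivative
`⟨η ⊗ g^⊗ ⊕ b ⊗ η ⊗ g^⊗ | λ(x) (ζ ⊗ f^⊗ ⊕ a ⊗ ζ ⊗ f^⊗)⟩`
(`HasQSDifferentialAt.hasDerivWithinAt_coherent`).  The vectors depend on `s`, so one continues up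
to a fixed `u > t` instead, where the quantum stochastic integral is an ordinary integral with `t` as
a right Lebesgue point, and uses adaptedness of `φ_s(x)` at `s` to remove the factor
`exp ((u - s) ⟨b | a⟩)`; differentiating this factor produces the term `1 ⊗ φ_t(x)` of the germ.  By
sesquilinearity the same holds for finite sums, and the resulting columns exhaust `𝔇_t ⊕ 𝔇_t^•`
(`exists_testColumn_eq`), since `a ⊗ ζ ⊗ f^⊗` alone arises from the difference of the continuations
by `a` and by `0`.

Conditional positivity follows: for given columns of the past, the positive quadratic form of `φ_s`
on the associated test vectors equals at `s = t` the form of `ι`.  If that vanishes, the right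
derivative, which is the form of `λ`, is nonnegative (`isCondPosDef_germ`).

Hermiticity: positive definiteness over a unital semigroup gives `φ_s(x⋆) = φ_s(x)†`
(`IsPosDef.star_apply`), and uniqueness of the derivative transfers this to `α(t)` on the past.
Adapted operators are determined by their restriction to the past (`IsCausal.eq_dagger`), so the
relations hold on all of `𝔇` and `𝒦 ⊗ 𝔇`.
-/

namespace QSGerm

/-! ### Constant one-particle functions on a time window -/

section Window

variable {K : Type*} [NormedAddCommGroup K]

/-- The one-particle function `a · 1_[t,s)`; it is `0` for `s ≤ t`. -/
noncomputable def window (t s : ℝ) (a : K) : OneParticle K :=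
  indicatorConstLp 2 (measurableSet_Ico : MeasurableSet (Set.Ico t s))
    ((Measure.restrict_apply_le _ _).trans_lt measure_Ico_lt_top).ne a

theorem window_coeFn (t s : ℝ) (a : K) :
    window t s a =ᵐ[volume.restrict (Set.Ici (0 : ℝ))] (Set.Ico t s).indicator fun _ => a :=
  indicatorConstLp_coeFn

theorem window_self (t : ℝ) (a : K) : window t t a = 0 := by
  refine Lp.ext ?_
  filter_upwards [window_coeFn t t a, Lp.coeFn_zero K 2 (volume.restrict (Set.Ici (0 : ℝ)))]
    with r h1 h2
  rw [h1, h2]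
  simp

theorem window_add {t s u : ℝ} (hts : t ≤ s) (hsu : s ≤ u) (a : K) :
    window t s a + window s u a = window t u a := by
  refine Lp.ext ?_
  filter_upwards [window_coeFn t s a, window_coeFn s u a, window_coeFn t u a,
    Lp.coeFn_add (window t s a) (window s u a)] with r h1 h2 h3 h4
  rw [h4, Pi.add_apply, h1, h2, h3]
  simp only [Set.indicator_apply, Set.mem_Ico]
  split_ifs <;> grind

theorem supportedFrom_zero (t : ℝ) : SupportedFrom t (0 : OneParticle K) := by
  filter_upwards [Lp.coeFn_zero K 2 (volume.restrict (Set.Ici (0 : ℝ)))] with r h1 _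
  rw [h1, Pi.zero_apply]

theorem supportedFrom_window (t s : ℝ) (a : K) : SupportedFrom t (window t s a) := by
  filter_upwards [window_coeFn t s a] with r h1 hr
  rw [h1, Set.indicator_of_notMem fun h => not_lt.mpr h.1 hr]

theorem supportedBefore_add_window {t s : ℝ} (hts : t ≤ s) {f : OneParticle K}
    (hf : SupportedBefore t f) (a : K) : SupportedBefore s (f + window t s a) := by
  filter_upwards [window_coeFn t s a, hf, Lp.coeFn_add f (window t s a)] with r h1 h2 h3 hr
  rw [h3, Pi.add_apply, h1, h2 (hts.trans hr), Set.indicator_of_notMem fun h => not_lt.mpr hr h.2,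
    add_zero]

/-- A function living on `[0, t)`, continued by the constant `a`, takes the value `a` after `t`. -/
theorem add_window_apply {t u : ℝ} (ht : 0 ≤ t) {f : OneParticle K} (hf : SupportedBefore t f)
    (a : K) : ∀ᵐ r, r ∈ Set.Ico t u → (f + window t u a) r = a := by
  have h : ∀ᵐ r ∂volume.restrict (Set.Ici (0 : ℝ)), r ∈ Set.Ico t u →
      (f + window t u a) r = a := by
    filter_upwards [window_coeFn t u a, hf, Lp.coeFn_add f (window t u a)] with r h1 h2 h3 hr
    rw [h3, Pi.add_apply, h1, h2 hr.1, Set.indicator_of_mem hr, zero_add]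
  filter_upwards [(ae_restrict_iff' measurableSet_Ici).mp h] with r hr hr'
  exact hr (ht.trans hr'.1) hr'

/-- Every one-particle function splits at time `t` into a past and a future part. -/
theorem exists_supportedBefore_add_supportedFrom (t : ℝ) (f : OneParticle K) :
    ∃ f₁ f₂ : OneParticle K, SupportedBefore t f₁ ∧ SupportedFrom t f₂ ∧ f₁ + f₂ = f := by
  have hm := (Lp.memLp f).indicator (measurableSet_Iio : MeasurableSet (Set.Iio t))
  refine ⟨hm.toLp, f - hm.toLp, ?_, ?_, add_sub_cancel _ _⟩
  · filter_upwards [hm.coeFn_toLp] with r h1 hr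
    rw [h1, Set.indicator_of_notMem (Set.notMem_Iio.mpr hr)]
  · filter_upwards [hm.coeFn_toLp, Lp.coeFn_sub f hm.toLp] with r h1 h2 hr
    rw [h2, Pi.sub_apply, h1, Set.indicator_of_mem (Set.mem_Iio.mpr hr), sub_self]

theorem inner_window [InnerProductSpace ℂ K] {s u : ℝ} (hs : 0 ≤ s) (hsu : s ≤ u) (a b : K) :
    inner ℂ (window s u b) (window s u a) = ((u - s : ℝ) : ℂ) * inner ℂ b a := by
  have h : ∀ᵐ r ∂(volume.restrict (Set.Ici (0 : ℝ))), r ∈ Set.Ico s u →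
      inner ℂ b (window s u a r) = inner ℂ b a := by
    filter_upwards [window_coeFn s u a] with r h1 hr
    rw [h1, Set.indicator_of_mem hr]
  have hI : Set.Ico s u ∩ Set.Ici 0 = Set.Ico s u :=
    Set.inter_eq_left.mpr fun r hr => hs.trans hr.1
  have hL : inner ℂ (window s u b) (window s u a) =
      ∫ r in Set.Ico s u, inner ℂ b (window s u a r) ∂(volume.restrict (Set.Ici (0 : ℝ))) :=
    L2.inner_indicatorConstLp_eq_setIntegral_inner _ _ _ _ _
  rw [hL, setIntegral_congr_ae measurableSet_Ico h, Measure.restrict_restrict measurableSet_Ico, hI]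
  simp [hsu]

end Window

/-! ### Causal forms -/

section Causal

variable {D K : Type*} [NormedAddCommGroup D] [InnerProductSpace ℂ D] [NormedAddCommGroup K]

theorem tensorCoherent_coherent (f g : OneParticle K) (ζ : D) :
    tensorCoherent f (coherent ζ g) = coherent ζ (g + f) := by
  simp [tensorCoherent, coherent]

theorem tensorCoherent_zero (h : CoherentSpan D K) : tensorCoherent 0 h = h := by
  simp only [tensorCoherent, add_zero, Finsupp.lmapDomain_apply]
  exact Finsupp.mapDomain_id

variable [InnerProductSpace ℂ K]

theorem bulletTensorCoherent_tmul (f : OneParticle K) (a : K) (h : CoherentSpan D K) :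
    bulletTensorCoherent f (a ⊗ₜ[ℂ] h) = a ⊗ₜ[ℂ] tensorCoherent f h := by
  simp [bulletTensorCoherent]

theorem bulletTensorCoherent_zero (h : BulletSpan D K) : bulletTensorCoherent 0 h = h := by
  have : (tensorCoherent 0 : CoherentSpan D K →ₗ[ℂ] CoherentSpan D K) = LinearMap.id :=
    LinearMap.ext tensorCoherent_zero
  simp [bulletTensorCoherent, this]

theorem coherent_mem_past {t : ℝ} {f : OneParticle K} (hf : SupportedBefore t f) (ζ : D) :
    coherent ζ f ∈ past D K t :=
  Submodule.subset_span ⟨ζ, f, hf, rfl⟩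

theorem tmul_mem_bulletPast {t : ℝ} {h : CoherentSpan D K} (hh : h ∈ past D K t) (a : K) :
    a ⊗ₜ[ℂ] h ∈ bulletPast D K t :=
  ⟨a ⊗ₜ[ℂ] ⟨h, hh⟩, by simp⟩

/-- A causal form is determined by its values on the past: the future only contributes the factor
`exp ⟨g | f⟩`. -/
theorem IsCausal.apply_eq {V W : Type*} [AddCommGroup V] [Module ℂ V] [AddCommGroup W]
    [Module ℂ W] {t : ℝ} {Vt : Submodule ℂ V} {TV : OneParticle K → V →ₗ[ℂ] V}
    {Wt : Submodule ℂ W} {TW : OneParticle K → W →ₗ[ℂ] W} {Q : FormOp V W}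
    (hQ : IsCausal t Vt TV Wt TW Q) (hV : ∀ v, TV 0 v = v) (hW : ∀ w, TW 0 w = w)
    {v : V} (hv : v ∈ Vt) {w : W} (hw : w ∈ Wt) {f g : OneParticle K}
    (hf : SupportedFrom t f) (hg : SupportedFrom t g) :
    Q (TV f v) (TW g w) = Q v w * coherentKernel g f := by
  obtain ⟨w', hw'⟩ := hQ v hv
  have h0 := hw' 0 (supportedFrom_zero t) ⟨w, hw⟩ 0 (supportedFrom_zero t)
  rw [hV, hW] at h0
  rw [hw' f hf ⟨w, hw⟩ g hg, h0]
  simp [coherentKernel]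

theorem coherentKernel_window {s u : ℝ} (hs : 0 ≤ s) (hsu : s ≤ u) (a b : K) :
    coherentKernel (window s u b) (window s u a) =
      Complex.exp (((u - s : ℝ) : ℂ) * inner ℂ b a) := by
  rw [coherentKernel, inner_window hs hsu]

/-- The entries of an adapted block matrix all scale by `exp ⟨g | f⟩` when a future is adjoined. -/
theorem BlockForm.IsAdapted.form_eq {t : ℝ} {A : BlockForm D K} (hA : A.IsAdapted t)
    {h k : CoherentSpan D K} (hh : h ∈ past D K t) (hk : k ∈ past D K t) (a b : K)
    {f g : OneParticle K} (hf : SupportedFrom t f) (hg : SupportedFrom t g) :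
    A.form (tensorCoherent g h, b ⊗ₜ[ℂ] tensorCoherent g h)
        (tensorCoherent f k, a ⊗ₜ[ℂ] tensorCoherent f k) =
      A.form (h, b ⊗ₜ[ℂ] h) (k, a ⊗ₜ[ℂ] k) * coherentKernel g f := by
  simp only [BlockForm.form, ← bulletTensorCoherent_tmul]
  rw [hA.mp.apply_eq tensorCoherent_zero tensorCoherent_zero hk hh hf hg,
    hA.mb.apply_eq bulletTensorCoherent_zero tensorCoherent_zero (tmul_mem_bulletPast hk a) hh hf hg,
    hA.bp.apply_eq tensorCoherent_zero bulletTensorCoherent_zero hk (tmul_mem_bulletPast hh b) hf hg,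
    hA.bb.apply_eq bulletTensorCoherent_zero bulletTensorCoherent_zero (tmul_mem_bulletPast hk a)
      (tmul_mem_bulletPast hh b) hf hg]
  ring

end Causal

/-! ### Test vectors -/

section TestVector

variable {D K : Type*} [NormedAddCommGroup D] [InnerProductSpace ℂ D] [NormedAddCommGroup K]

/-- Formal sums of triples `ζ ⊗ (a, f)` with `ζ ∈ 𝒟`, `a ∈ 𝒦` and `f` living on `[0, t)`. They
parametrize the test vectors `∑ ζ ⊗ (f + a · 1_[t,s))^⊗`. -/
abbrev TestSum (D K : Type*) [NormedAddCommGroup D] [NormedAddCommGroup K] (t : ℝ) : Type _ :=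
  (K × {f : OneParticle K // SupportedBefore t f}) →₀ D

/-- The test vector `∑ ζ ⊗ (f + a · 1_[t,s))^⊗ ∈ 𝔇`. -/
noncomputable def testVector (t s : ℝ) : TestSum D K t →ₗ[ℂ] CoherentSpan D K :=
  Finsupp.lmapDomain D ℂ fun p => (p.2 : OneParticle K) + window t s p.1

theorem testVector_single (t s : ℝ) (p : K × {f : OneParticle K // SupportedBefore t f}) (ζ : D) :
    testVector t s (Finsupp.single p ζ) = coherent ζ ((p.2 : OneParticle K) + window t s p.1) := by
  simp [testVector, coherent]

variable [InnerProductSpace ℂ K]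

/-- The column `(∑ ζ ⊗ f^⊗, ∑ a ⊗ (ζ ⊗ f^⊗))` in `𝔇_t ⊕ 𝔇_t^•`: the germ at `s = t` of the test
vector. -/
noncomputable def testColumn (t : ℝ) : TestSum D K t →ₗ[ℂ] CoherentSpan D K × BulletSpan D K :=
  Finsupp.lsum ℂ fun p =>
    (LinearMap.prod LinearMap.id (TensorProduct.mk ℂ K (CoherentSpan D K) p.1)) ∘ₗ
      Finsupp.lsingle (p.2 : OneParticle K)

theorem testColumn_single (t : ℝ) (p : K × {f : OneParticle K // SupportedBefore t f}) (ζ : D) :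
    testColumn t (Finsupp.single p ζ) =
      (coherent ζ (p.2 : OneParticle K), p.1 ⊗ₜ[ℂ] coherent ζ (p.2 : OneParticle K)) := by
  simp [testColumn, coherent]

theorem testVector_self (t : ℝ) (m : TestSum D K t) : testVector t t m = (testColumn t m).1 := by
  induction m using Finsupp.induction_linear with
  | zero => simp
  | add m m' h h' => rw [map_add, map_add, h, h', Prod.fst_add]
  | single p ζ => rw [testVector_single, testColumn_single, window_self, add_zero]

/-- Test sums represent every column of the past: `a ⊗ ζ ⊗ f^⊗` alone is represented by
`ζ ⊗ (a, f) - ζ ⊗ (0, f)`. -/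
theorem exists_testColumn_eq {t : ℝ} {η : CoherentSpan D K × BulletSpan D K}
    (h1 : η.1 ∈ past D K t) (h2 : η.2 ∈ bulletPast D K t) : ∃ m, testColumn t m = η := by
  have hfst : ∀ h ∈ past D K t, (h, (0 : BulletSpan D K)) ∈ LinearMap.range (testColumn t) := by
    intro h hh
    induction hh using Submodule.span_induction with
    | mem h hh =>
      obtain ⟨ζ, f, hf, rfl⟩ := hh
      exact ⟨Finsupp.single (0, ⟨f, hf⟩) ζ, by rw [testColumn_single, TensorProduct.zero_tmul]⟩
    | zero => exact Submodule.zero_mem _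
    | add h h' _ _ i i' => simpa using Submodule.add_mem _ i i'
    | smul c h _ i => simpa using Submodule.smul_mem _ c i
  have hsnd : ∀ (a : K), ∀ h ∈ past D K t,
      ((0 : CoherentSpan D K), a ⊗ₜ[ℂ] h) ∈ LinearMap.range (testColumn t) := by
    intro a h hh
    induction hh using Submodule.span_induction with
    | mem h hh =>
      obtain ⟨ζ, f, hf, rfl⟩ := hh
      refine ⟨Finsupp.single (a, ⟨f, hf⟩) ζ - Finsupp.single (0, ⟨f, hf⟩) ζ, ?_⟩
      rw [map_sub, testColumn_single, testColumn_single, TensorProduct.zero_tmul]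
      simp
    | zero => rw [TensorProduct.tmul_zero]; exact Submodule.zero_mem _
    | add h h' _ _ i i' => simpa [TensorProduct.tmul_add] using Submodule.add_mem _ i i'
    | smul c h _ i => simpa using Submodule.smul_mem _ c i
  have hsnd' : ((0 : CoherentSpan D K), η.2) ∈ LinearMap.range (testColumn t) := by
    obtain ⟨w, hw⟩ := h2
    rw [← hw]
    clear hw
    induction w using TensorProduct.induction_on with
    | zero => rw [map_zero]; exact Submodule.zero_mem _
    | tmul a h => simpa using hsnd a h h.2
    | add w w' i i' => simpa using Submodule.add_mem _ i i'
  simpa using Submodule.add_mem _ (hfst η.1 h1) hsnd'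

end TestVector

/-! ### The right derivative of a process at `t` -/

section Derivative

variable {B D K : Type*} [NormedAddCommGroup D] [InnerProductSpace ℂ D]
  [NormedAddCommGroup K] [InnerProductSpace ℂ K]

/-- On coherent vectors whose one-particle functions are constant on `[t, u)`, the four integrals
of the differential combine into a single one, over fixed vectors `𝐡` and `𝐤`. -/
theorem HasQSDifferentialAt.sub_eq_integral
    {φ : ℝ → B → FormOp (CoherentSpan D K) (CoherentSpan D K)} {α : ℝ → B → BlockForm D K} {t : ℝ}
    (hα : HasQSDifferentialAt φ α t) (x : B) {s u : ℝ} (ht : 0 ≤ t) (hts : t ≤ s) (hsu : s < u)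
    (η ζ : D) (a b : K) {g f : OneParticle K}
    (hf : ∀ᵐ r, r ∈ Set.Ico t u → f r = a) (hg : ∀ᵐ r, r ∈ Set.Ico t u → g r = b) :
    φ s x (coherent ζ f) (coherent η g) - φ t x (coherent ζ f) (coherent η g) =
      ∫ r in t..s, (α r x).form (coherent η g, b ⊗ₜ[ℂ] coherent η g)
        (coherent ζ f, a ⊗ₜ[ℂ] coherent ζ f) := by
  obtain ⟨i1, i2, i3, i4, e⟩ := hα.integral s (ht.trans hts) x η ζ g f
  obtain ⟨j1, j2, j3, j4, e'⟩ := hα.integral t ht x η ζ g f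
  set h := coherent η g
  set k := coherent ζ f
  have hsub : φ s x k h - φ t x k h = (φ s x - φ 0 x) k h - (φ t x - φ 0 x) k h := by
    simp
  rw [hsub, e, e']
  have k1 := j1.symm.trans i1
  have k2 := j2.symm.trans i2
  have k3 := j3.symm.trans i3
  have k4 := j4.symm.trans i4
  have hsum : ∫ r in t..s, (α r x).form (h, b ⊗ₜ[ℂ] h) (k, a ⊗ₜ[ℂ] k) =
      ∫ r in t..s, ((α r x).bb (f r ⊗ₜ[ℂ] k) (g r ⊗ₜ[ℂ] h) + (α r x).bp k (g r ⊗ₜ[ℂ] h) +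
        (α r x).mb (f r ⊗ₜ[ℂ] k) h + (α r x).mp k h) := by
    refine intervalIntegral.integral_congr_ae ?_
    filter_upwards [hf, hg] with r h1 h2 hr
    rw [Set.uIoc_of_le hts] at hr
    have hr' : r ∈ Set.Ico t u := ⟨hr.1.le, hr.2.trans_lt hsu⟩
    rw [h1 hr', h2 hr', BlockForm.form]
    ring
  rw [hsum, intervalIntegral.integral_add ((k1.add k2).add k3) k4,
    intervalIntegral.integral_add (k1.add k2) k3, intervalIntegral.integral_add k1 k2,
    ← intervalIntegral.integral_interval_sub_left i1 j1,
    ← intervalIntegral.integral_interval_sub_left i2 j2,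
    ← intervalIntegral.integral_interval_sub_left i3 j3,
    ← intervalIntegral.integral_interval_sub_left i4 j4]
  ring

/-- A right Lebesgue point of `F` is a point of right differentiability of its indefinite
integral. -/
theorem IsRightLebesguePoint.hasDerivWithinAt {F J : ℝ → ℂ} {t u : ℝ} (htu : t < u)
    (hF : IsRightLebesguePoint F t) (hJ : ∀ s, t ≤ s → s < u → J s - J t = ∫ r in t..s, F r) :
    HasDerivWithinAt J (F t) (Set.Ioi t) t := by
  rw [hasDerivWithinAt_iff_tendsto_slope' Set.self_notMem_Ioi]
  refine hF.2.congr' ?_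
  filter_upwards [Ioo_mem_nhdsGT htu] with s hs
  rw [← hJ s hs.1.le hs.2, slope_def_module, Complex.real_smul, Complex.ofReal_inv]

theorem germ_eq (φ : ℝ → B → FormOp (CoherentSpan D K) (CoherentSpan D K))
    (α : ℝ → B → BlockForm D K) (t : ℝ) (x : B) :
    germ φ α t x =
      ⟨(α t x).mp, (α t x).mb, (α t x).bp, ampliate K (φ t x) + (α t x).bb⟩ := by
  change BlockForm.mk (0 + (α t x).mp) (0 + (α t x).mb) (0 + (α t x).bp)
    (ampliate K (φ t x) + (α t x).bb) = _
  simp only [zero_add]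

theorem germ_form (φ : ℝ → B → FormOp (CoherentSpan D K) (CoherentSpan D K))
    (α : ℝ → B → BlockForm D K) (t : ℝ) (x : B) (h k : CoherentSpan D K × BulletSpan D K) :
    (germ φ α t x).form h k = ampliate K (φ t x) k.2 h.2 + (α t x).form h k := by
  simp only [germ_eq, LinearMap.add_apply, BlockForm.form]
  ring

/-- For coherent vectors of the past, continued on `[t, s)` by constants `a` and `b`, the right
derivative at `s = t` of the matrix element of `φ_s(x)` is a matrix element of the germ.  The
ampliation `1 ⊗ φ_t(x)` in the germ comes from the derivative of the factor `exp ((s - t) ⟨b | a⟩)`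
by which `φ_t(x)` grows when such a continuation is adjoined. -/
theorem HasQSDifferentialAt.hasDerivWithinAt_coherent
    {φ : ℝ → B → FormOp (CoherentSpan D K) (CoherentSpan D K)} {α : ℝ → B → BlockForm D K} {t : ℝ}
    (hα : HasQSDifferentialAt φ α t) (ht : 0 ≤ t) {x : B}
    (hφ : ∀ s, 0 ≤ s → IsAdaptedForm s (φ s x)) (η ζ : D) (a b : K) {g f : OneParticle K}
    (hf : SupportedBefore t f) (hg : SupportedBefore t g) :
    HasDerivWithinAt
      (fun s => φ s x (coherent ζ (f + window t s a)) (coherent η (g + window t s b)))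
      ((germ φ α t x).form (coherent η g, b ⊗ₜ[ℂ] coherent η g)
        (coherent ζ f, a ⊗ₜ[ℂ] coherent ζ f)) (Set.Ioi t) t := by
  -- The derivative is taken on fixed vectors, continued up to `u = t + 1`; adaptedness of `φ s x`
  -- at `s` relates them to the vectors continued up to `s`.
  set u := t + 1 with hu
  have htu : t < u := by linarith
  have hJ := (hα.regular x
    (coherent η (g + window t u b), b ⊗ₜ[ℂ] coherent η (g + window t u b))
    (coherent ζ (f + window t u a), a ⊗ₜ[ℂ] coherent ζ (f + window t u a))).hasDerivWithinAt htu
    (J := fun s => φ s x (coherent ζ (f + window t u a)) (coherent η (g + window t u b)))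
    fun s hts hsu => hα.sub_eq_integral x ht hts hsu η ζ a b (add_window_apply ht hf a)
      (add_window_apply ht hg b)
  set c : ℂ := inner ℂ b a with hc
  have hsplit : ∀ s, t ≤ s → s ≤ u →
      φ s x (coherent ζ (f + window t u a)) (coherent η (g + window t u b)) =
      φ s x (coherent ζ (f + window t s a)) (coherent η (g + window t s b)) *
        Complex.exp (((u - s : ℝ) : ℂ) * c) := by
    intro s hts hsu
    rw [← window_add hts hsu a, ← window_add hts hsu b, ← add_assoc, ← add_assoc,
      ← tensorCoherent_coherent (window s u a), ← tensorCoherent_coherent (window s u b),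
      (hφ s (ht.trans hts)).apply_eq tensorCoherent_zero tensorCoherent_zero
        (coherent_mem_past (supportedBefore_add_window hts hf a) ζ)
        (coherent_mem_past (supportedBefore_add_window hts hg b) η)
        (supportedFrom_window s u a) (supportedFrom_window s u b),
      coherentKernel_window (ht.trans hts) hsu]
  have hG := (hα.adapted t ht x).form_eq (coherent_mem_past hg η) (coherent_mem_past hf ζ) a b
    (supportedFrom_window t u a) (supportedFrom_window t u b)
  rw [tensorCoherent_coherent, tensorCoherent_coherent, coherentKernel_window ht htu.le, ← hc] at hG
  rw [hG] at hJ
  have hE : HasDerivWithinAt (fun s : ℝ => Complex.exp (-(((u - s : ℝ) : ℂ) * c)))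
      (Complex.exp (-(((u - t : ℝ) : ℂ) * c)) * c) (Set.Ioi t) t := by
    have h1 : HasDerivAt (fun s : ℝ => -(((u - s : ℝ) : ℂ) * c)) c t := by
      have h2 : HasDerivAt (fun s : ℝ => ((u - s : ℝ) : ℂ)) ((-1 : ℝ) : ℂ) t :=
        ((hasDerivAt_id t).const_sub u).ofReal_comp
      exact (h2.mul_const c).neg.congr_deriv (by simp)
    exact h1.cexp.hasDerivWithinAt
  have hP := hJ.mul hE
  have hexp : Complex.exp (((u - t : ℝ) : ℂ) * c) * Complex.exp (-(((u - t : ℝ) : ℂ) * c)) = 1 := by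
    rw [← Complex.exp_add, add_neg_cancel, Complex.exp_zero]
  refine (hP.congr_of_eventuallyEq ?_ ?_).congr_deriv ?_
  · filter_upwards [Ioo_mem_nhdsGT htu] with s hs
    simp only [Pi.mul_apply]
    rw [hsplit s hs.1.le hs.2.le, mul_assoc, ← Complex.exp_add, add_neg_cancel, Complex.exp_zero,
      mul_one]
  · simp only [Pi.mul_apply]
    rw [hsplit t le_rfl htu.le, mul_assoc, hexp, mul_one]
  · rw [hsplit t le_rfl htu.le, window_self, window_self, add_zero, add_zero, germ_form,
      ampliate_tmul, ← hc]
    linear_combination ((α t x).form (coherent η g, b ⊗ₜ[ℂ] coherent η g)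
        (coherent ζ f, a ⊗ₜ[ℂ] coherent ζ f) + φ t x (coherent ζ f) (coherent η g) * c) * hexp

theorem BlockForm.form_add_left (A : BlockForm D K) (h h' k : CoherentSpan D K × BulletSpan D K) :
    A.form (h + h') k = A.form h k + A.form h' k := by
  simp only [BlockForm.form, Prod.fst_add, Prod.snd_add, map_add]
  ring

theorem BlockForm.form_add_right (A : BlockForm D K) (h k k' : CoherentSpan D K × BulletSpan D K) :
    A.form h (k + k') = A.form h k + A.form h k' := by
  simp only [BlockForm.form, Prod.fst_add, Prod.snd_add, map_add, LinearMap.add_apply]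
  ring

/-- The matrix elements of the germ between columns of the past are right derivatives of matrix
elements of the process. -/
theorem HasQSDifferentialAt.hasDerivWithinAt
    {φ : ℝ → B → FormOp (CoherentSpan D K) (CoherentSpan D K)} {α : ℝ → B → BlockForm D K} {t : ℝ}
    (hα : HasQSDifferentialAt φ α t) (ht : 0 ≤ t) {x : B}
    (hφ : ∀ s, 0 ≤ s → IsAdaptedForm s (φ s x)) (m m' : TestSum D K t) :
    HasDerivWithinAt (fun s => φ s x (testVector t s m) (testVector t s m'))
      ((germ φ α t x).form (testColumn t m') (testColumn t m)) (Set.Ioi t) t := by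
  induction m using Finsupp.induction_linear with
  | zero => simpa [BlockForm.form] using hasDerivWithinAt_const t (Set.Ioi t) (0 : ℂ)
  | add m₁ m₂ h₁ h₂ =>
    simp only [map_add, LinearMap.add_apply, BlockForm.form_add_right]
    exact h₁.add h₂
  | single p ζ =>
    induction m' using Finsupp.induction_linear with
    | zero => simpa [BlockForm.form] using hasDerivWithinAt_const t (Set.Ioi t) (0 : ℂ)
    | add m₁ m₂ h₁ h₂ =>
      simp only [map_add, BlockForm.form_add_left]
      exact h₁.add h₂
    | single q η =>
      simp only [testVector_single, testColumn_single]
      exact hα.hasDerivWithinAt_coherent ht hφ η ζ p.1 q.1 p.2.2 q.2.2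

end Derivative

/-! ### Hermiticity -/

section Hermitian

variable {B D K : Type*} [NormedAddCommGroup D] [InnerProductSpace ℂ D]
  [NormedAddCommGroup K]

/-- Over a unital semigroup with involution, positive definiteness of pairs `1, x` forces
`ψ(x⋆) = ψ(x)†`. -/
theorem IsPosDef.star_apply [Monoid B] [StarMul B]
    {ψ : B → FormOp (CoherentSpan D K) (CoherentSpan D K)} (hψ : IsPosDef ψ) (x : B)
    (h k : CoherentSpan D K) : ψ (star x) k h = conj (ψ x h k) := by
  have hdiag : ∀ (y : B) (v : CoherentSpan D K), (ψ (star y * y) v v).im = 0 := by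
    intro y v
    have h1 := hψ 1 (fun _ => y) (fun _ => v)
    simp only [Fin.sum_univ_one] at h1
    exact (Complex.le_def.mp h1).2.symm
  have hone : ∀ v : CoherentSpan D K, (ψ 1 v v).im = 0 := by
    intro v
    simpa using hdiag 1 v
  have hcross : ∀ v : CoherentSpan D K, (ψ (star x) v h).im + (ψ x h v).im = 0 := by
    intro v
    have h1 := (Complex.le_def.mp (hψ 2 ![1, x] ![v, h])).2
    simp [Fin.sum_univ_two, hone, hdiag] at h1
    linarith
  have h1 := hcross k
  have h2 := hcross (Complex.I • k)
  rw [map_smul, LinearMap.smul_apply, LinearMap.map_smulₛₗ] at h2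
  simp at h2
  refine Complex.ext ?_ ?_
  · rw [Complex.conj_re]; linarith
  · rw [Complex.conj_im]; linarith

variable [InnerProductSpace ℂ K]

theorem dagger_apply {V W : Type*} [AddCommGroup V] [Module ℂ V] [AddCommGroup W] [Module ℂ W]
    (Q : FormOp V W) (v : V) (w : W) : dagger Q w v = conj (Q v w) := rfl

theorem ampliate_star_apply {V : Type*} [AddCommGroup V] [Module ℂ V] {Q R : FormOp V V}
    (hQR : ∀ h k, R k h = conj (Q h k)) (h k : K ⊗[ℂ] V) :
    ampliate K R k h = conj (ampliate K Q h k) := by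
  induction k using TensorProduct.induction_on with
  | zero => simp
  | add k k' i i' => simp [i, i']
  | tmul b k =>
    induction h using TensorProduct.induction_on with
    | zero => simp
    | add h h' i i' => simp [i, i']
    | tmul a h => simp [ampliate_tmul, hQR h k]

/-- Two causal forms that are adjoint on the past are adjoint, provided that the past and the
futures generate the whole spaces. -/
theorem IsCausal.eq_dagger {V W : Type*} [AddCommGroup V] [Module ℂ V] [AddCommGroup W]
    [Module ℂ W] {t : ℝ} {Vt : Submodule ℂ V} {TV : OneParticle K → V →ₗ[ℂ] V}
    {Wt : Submodule ℂ W} {TW : OneParticle K → W →ₗ[ℂ] W} {Q : FormOp V W} {R : FormOp W V}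
    (hQ : IsCausal t Vt TV Wt TW Q) (hR : IsCausal t Wt TW Vt TV R)
    (hV : ∀ v, TV 0 v = v) (hW : ∀ w, TW 0 w = w)
    (hV' : Submodule.span ℂ {v | ∃ v' ∈ Vt, ∃ f, SupportedFrom t f ∧ v = TV f v'} = ⊤)
    (hW' : Submodule.span ℂ {w | ∃ w' ∈ Wt, ∃ g, SupportedFrom t g ∧ w = TW g w'} = ⊤)
    (h : ∀ v ∈ Vt, ∀ w ∈ Wt, R w v = conj (Q v w)) : R = dagger Q := by
  refine LinearMap.ext_on hW' ?_
  rintro _ ⟨w, hw, g, hg, rfl⟩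
  refine LinearMap.ext_on hV' ?_
  rintro _ ⟨v, hv, f, hf, rfl⟩
  rw [dagger_apply, hQ.apply_eq hV hW hv hw hf hg, hR.apply_eq hW hV hw hv hg hf, h v hv w hw,
    map_mul, coherentKernel, coherentKernel, ← Complex.exp_conj, inner_conj_symm]

theorem span_tensorCoherent_past (t : ℝ) :
    Submodule.span ℂ {h : CoherentSpan D K |
      ∃ h' ∈ past D K t, ∃ f, SupportedFrom t f ∧ h = tensorCoherent f h'} = ⊤ := by
  rw [eq_top_iff]
  rintro h -
  induction h using Finsupp.induction_linear with
  | zero => exact Submodule.zero_mem _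
  | add h h' i i' => exact Submodule.add_mem _ i i'
  | single f ζ =>
    obtain ⟨f₁, f₂, h₁, h₂, rfl⟩ := exists_supportedBefore_add_supportedFrom t f
    exact Submodule.subset_span
      ⟨coherent ζ f₁, coherent_mem_past h₁ ζ, f₂, h₂, (tensorCoherent_coherent f₂ f₁ ζ).symm⟩

theorem span_bulletTensorCoherent_bulletPast (t : ℝ) :
    Submodule.span ℂ {h : BulletSpan D K |
      ∃ h' ∈ bulletPast D K t, ∃ f, SupportedFrom t f ∧ h = bulletTensorCoherent f h'} = ⊤ := by
  rw [eq_top_iff]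
  rintro h -
  induction h using TensorProduct.induction_on with
  | zero => exact Submodule.zero_mem _
  | add h h' i i' => exact Submodule.add_mem _ i i'
  | tmul a h =>
    have hh : h ∈ Submodule.span ℂ {h : CoherentSpan D K |
        ∃ h' ∈ past D K t, ∃ f, SupportedFrom t f ∧ h = tensorCoherent f h'} := by
      rw [span_tensorCoherent_past]; trivial
    induction hh using Submodule.span_induction with
    | mem h hh =>
      obtain ⟨h', hh', f, hf, rfl⟩ := hh
      exact Submodule.subset_span
        ⟨a ⊗ₜ[ℂ] h', tmul_mem_bulletPast hh' a, f, hf, (bulletTensorCoherent_tmul f a h').symm⟩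
    | zero => rw [TensorProduct.tmul_zero]; exact Submodule.zero_mem _
    | add h h' _ _ i i' => rw [TensorProduct.tmul_add]; exact Submodule.add_mem _ i i'
    | smul c h _ i => rw [TensorProduct.tmul_smul]; exact Submodule.smul_mem _ c i

variable [Monoid B] [StarMul B]
  {φ : ℝ → B → FormOp (CoherentSpan D K) (CoherentSpan D K)} {α : ℝ → B → BlockForm D K} {t : ℝ}

/-- On columns of the past the derivative inherits Hermiticity from the process. -/
theorem HasQSDifferentialAt.star_form_of_past (hφ : IsAdaptedPDProcess φ) (ht : 0 ≤ t)
    (hα : HasQSDifferentialAt φ α t) (x : B) {h k : CoherentSpan D K × BulletSpan D K}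
    (h1 : h.1 ∈ past D K t) (h2 : h.2 ∈ bulletPast D K t)
    (k1 : k.1 ∈ past D K t) (k2 : k.2 ∈ bulletPast D K t) :
    (α t (star x)).form h k = conj ((α t x).form k h) := by
  obtain ⟨m', rfl⟩ := exists_testColumn_eq h1 h2
  obtain ⟨m, rfl⟩ := exists_testColumn_eq k1 k2
  have d1 := hα.hasDerivWithinAt ht (fun s hs => hφ.adapted s hs (star x)) m m'
  have d2 := (hα.hasDerivWithinAt ht (fun s hs => hφ.adapted s hs x) m' m).star
  have hstar : ∀ s, t ≤ s → φ s (star x) (testVector t s m) (testVector t s m') =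
      conj (φ s x (testVector t s m') (testVector t s m)) := fun s hs =>
    (hφ.posDef s (ht.trans hs)).star_apply x _ _
  have d3 := d2.congr (fun s hs => hstar s (Set.mem_Ioi.mp hs).le) (hstar t le_rfl)
  have e := (uniqueDiffWithinAt_Ioi t).eq_deriv _ d1 d3
  rw [germ_form, germ_form, star_add] at e
  have hamp := ampliate_star_apply ((hφ.posDef t ht).star_apply x) (testColumn t m').2
    (testColumn t m).2
  rw [hamp] at e
  exact add_left_cancel e

/-- The derivative `α(t, ·)` is Hermitian entry by entry: on the past its entries are separated by
columns with one zero component, and causality extends this to the whole space. -/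
theorem HasQSDifferentialAt.star_eq_dagger (hφ : IsAdaptedPDProcess φ) (ht : 0 ≤ t)
    (hα : HasQSDifferentialAt φ α t) (x : B) :
    (α t (star x)).mp = dagger (α t x).mp ∧ (α t (star x)).bp = dagger (α t x).mb ∧
      (α t (star x)).bb = dagger (α t x).bb := by
  have hx := hα.adapted t ht x
  have hx' := hα.adapted t ht (star x)
  have key := fun (h k : CoherentSpan D K × BulletSpan D K) (h1 : h.1 ∈ past D K t)
    (h2 : h.2 ∈ bulletPast D K t) (k1 : k.1 ∈ past D K t) (k2 : k.2 ∈ bulletPast D K t) =>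
    hα.star_form_of_past hφ ht x h1 h2 k1 k2
  refine ⟨?_, ?_, ?_⟩
  · refine hx.mp.eq_dagger hx'.mp tensorCoherent_zero tensorCoherent_zero
      (span_tensorCoherent_past t) (span_tensorCoherent_past t) fun v hv w hw => ?_
    simpa [BlockForm.form] using key (v, 0) (w, 0) hv (zero_mem _) hw (zero_mem _)
  · refine hx.mb.eq_dagger hx'.bp bulletTensorCoherent_zero tensorCoherent_zero
      (span_bulletTensorCoherent_bulletPast t) (span_tensorCoherent_past t) fun v hv w hw => ?_
    simpa [BlockForm.form] using key (0, v) (w, 0) (zero_mem _) hv hw (zero_mem _)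
  · refine hx.bb.eq_dagger hx'.bb bulletTensorCoherent_zero bulletTensorCoherent_zero
      (span_bulletTensorCoherent_bulletPast t) (span_bulletTensorCoherent_bulletPast t)
      fun v hv w hw => ?_
    simpa [BlockForm.form] using key (0, v) (0, w) (zero_mem _) hv (zero_mem _) hw

end Hermitian

/-! ### Conditional positivity -/

section Positivity

/-- A function that vanishes at `t` and is nonnegative after `t` has a nonnegative right
derivative at `t`. -/
theorem nonneg_of_hasDerivWithinAt_Ioi {P : ℝ → ℂ} {P' : ℂ} {t : ℝ}
    (hP : HasDerivWithinAt P P' (Set.Ioi t) t) (h0 : P t = 0) (hpos : ∀ s, t < s → 0 ≤ P s) :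
    0 ≤ P' := by
  rw [hasDerivWithinAt_iff_tendsto_slope' Set.self_notMem_Ioi] at hP
  refine ge_of_tendsto hP ?_
  filter_upwards [self_mem_nhdsWithin] with s hs
  rw [slope_def_module, h0, sub_zero]
  exact smul_nonneg (inv_nonneg.mpr (sub_nonneg.mpr (Set.mem_Ioi.mp hs).le)) (hpos s hs)

variable {B D K : Type*} [NormedAddCommGroup D] [InnerProductSpace ℂ D]
  [NormedAddCommGroup K] [InnerProductSpace ℂ K]

theorem cornerBlock_form (Q : FormOp (CoherentSpan D K) (CoherentSpan D K))
    (h k : CoherentSpan D K × BulletSpan D K) : (cornerBlock Q).form h k = Q k.1 h.1 := by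
  simp [BlockForm.form, cornerBlock]

theorem isCondPosDef_germ [Mul B] [Star B]
    {φ : ℝ → B → FormOp (CoherentSpan D K) (CoherentSpan D K)} {α : ℝ → B → BlockForm D K} {t : ℝ}
    (hφ : IsAdaptedPDProcess φ) (ht : 0 ≤ t) (hα : HasQSDifferentialAt φ α t) :
    IsCondPosDef t (fun x => cornerBlock (φ t x)) (germ φ α t) := by
  intro n x η hη h0
  choose m hm using fun k => exists_testColumn_eq (hη k).1 (hη k).2
  simp only [← hm, cornerBlock_form, ← testVector_self] at h0 ⊢
  have hd : HasDerivWithinAt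
      (fun s => ∑ k, ∑ l, φ s (star (x l) * x k) (testVector t s (m k)) (testVector t s (m l)))
      (∑ k, ∑ l, (germ φ α t (star (x l) * x k)).form (testColumn t (m l)) (testColumn t (m k)))
      (Set.Ioi t) t :=
    HasDerivWithinAt.fun_sum fun k _ => HasDerivWithinAt.fun_sum fun l _ =>
      hα.hasDerivWithinAt ht (fun s hs => hφ.adapted s hs _) (m k) (m l)
  exact nonneg_of_hasDerivWithinAt_Ioi hd h0 fun s hs =>
    hφ.posDef s (ht.trans hs.le) n x fun k => testVector t s (m k)

end Positivity

end QSGerm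

theorem mainTheorem1 {B D K : Type*} [Monoid B] [StarMul B]
    [NormedAddCommGroup D] [InnerProductSpace ℂ D]
    [NormedAddCommGroup K] [InnerProductSpace ℂ K]
    (φ : ℝ → B → QSGerm.FormOp (QSGerm.CoherentSpan D K) (QSGerm.CoherentSpan D K))
    (α : ℝ → B → QSGerm.BlockForm D K)
    (hφ : QSGerm.IsAdaptedPDProcess φ)
    (t : ℝ) (ht : 0 ≤ t) (hα : QSGerm.HasQSDifferentialAt φ α t) :
    QSGerm.IsCondPosDef t (fun x => QSGerm.cornerBlock (φ t x)) (QSGerm.germ φ α t) ∧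
    (∀ x : B,
      (QSGerm.germ φ α t x).mp = (α t x).mp ∧
      (QSGerm.germ φ α t x).bp = (α t x).bp ∧
      (QSGerm.germ φ α t x).mb = (α t x).mb ∧
      (QSGerm.germ φ α t x).bb = QSGerm.ampliate K (φ t x) + (α t x).bb) ∧
    (∀ x : B,
      (QSGerm.germ φ α t (star x)).mp = QSGerm.dagger (QSGerm.germ φ α t x).mp ∧
      (QSGerm.germ φ α t (star x)).bp = QSGerm.dagger (QSGerm.germ φ α t x).mb ∧
      (QSGerm.germ φ α t (star x)).bb = QSGerm.dagger (QSGerm.germ φ α t x).bb) := by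
  refine ⟨QSGerm.isCondPosDef_germ hφ ht hα, fun x => ?_, fun x => ?_⟩
  · rw [QSGerm.germ_eq]
    exact ⟨rfl, rfl, rfl, rfl⟩
  · obtain ⟨h1, h2, h3⟩ := hα.star_eq_dagger hφ ht x
    rw [QSGerm.germ_eq, QSGerm.germ_eq]
    refine ⟨h1, h2, ?_⟩
    change QSGerm.ampliate K (φ t (star x)) + (α t (star x)).bb = _
    rw [h3]
    refine LinearMap.ext fun k => LinearMap.ext fun h => ?_
    rw [QSGerm.dagger_apply, LinearMap.add_apply, LinearMap.add_apply, LinearMap.add_apply,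
      LinearMap.add_apply, map_add, QSGerm.dagger_apply,
      QSGerm.ampliate_star_apply ((hφ.posDef t ht).star_apply x)]
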